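/- Consider $n\ge 1$ tasks on one processor. Task $i$ has a real period $T_i>0$, a real relative deadline $D_i>0$ (arbitrary, possibly larger than $T_i$) and a real execution time $C_i\ge 0$; its $j$-th job ($j=0,1,2,\dots$) is released at time $r_{i,j}=jT_i$, needs $C_i$ units of processor time, and has absolute deadline $d_{i,j}=r_{i,j}+D_i$. Assume that the periods have a hyperperiod $H$, i.e. a least positive real number that is an integer multiple of every $T_i$. Preemptive EDF executes, at every instant $t\ge 0$, a released and uncompleted job with earliest absolute deadline (ties broken arbitrarily), and idles only if there is no such job. The task set is *scheduled by preemptive EDF* if EDF schedules exist and in each of them every job receives its $C_i$ units of processor time by its absolute deadline. Let $$\mathcal D=\{jT_i+D_i:\ 1\le i\le n,\ j\in\mathbb N,\ jT_i+D_i\le H+\max_k D_k\}\cup\{0\},$$ $$h_i(t)=\begin{cases}\dfrac1{T_i}& t=0,\\[2mm] \dfrac1t\max\left\{0,\left\lfloor\dfrac{t-D_i}{T_i}\right\rfloor+1\right\}& t\ne0.\end{cases}$$ Then $\mathcal D$ is finite and, for every $\mathbf C=(C_1,\dots,C_n)$ with $C_i\ge 0$, the task set is scheduled by preemptive EDF if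 and only if $$\sum_{i=1}^n h_i(t)\,C_i\le 1\qquad\text{for all } t\in\mathcal D.$$ The same condition is necessary and sufficient for the task set to be scheduled by preemptive EDF under all sporadic releases, i.e. all release times with $r_{i,0}\ge 0$ and $r_{i,j+1}\ge r_{i,j}+T_i$. Consequently, the set of vectors $\mathbf C\ge 0$ for which the task set is scheduled by preemptive EDF is a convex polyhedron (a finite intersection of closed half-spaces), and in particular convex. -/

import Mathlib

open MeasureTheory Set

noncomputable section

namespace EDF

/-! Tasks are indexed by `Fin n`; the `j`-th job of task `i` is the pair `(i, j) : Fin n × ℕ`, with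
`j` counted from `0`. Periods `T`, relative deadlines `D` and execution times `C` are real vectors
and `r i j` is the release time of job `(i, j)`. -/

/-- `H` is the hyperperiod: the least positive real number that is an integer multiple of every
period. -/
def IsHyperperiod {n : ℕ} (T : Fin n → ℝ) (H : ℝ) : Prop :=
  IsLeast {x : ℝ | 0 < x ∧ ∀ i, ∃ k : ℕ, x = k * T i} H

/-- The synchronous periodic releases `r i j = j * T i`. -/
def periodicRelease {n : ℕ} (T : Fin n → ℝ) : Fin n → ℕ → ℝ := fun i j => j * T i

/-- The sporadic releases with minimum interarrival times `T`, from time `0` on. -/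
def IsSporadicRelease {n : ℕ} (T : Fin n → ℝ) (r : Fin n → ℕ → ℝ) : Prop :=
  (∀ i, 0 ≤ r i 0) ∧ ∀ i j, r i j + T i ≤ r i (j + 1)

/-- A single-processor preemptive schedule: at each instant `t ≥ 0` it selects the job that is
executing, or `none` if the processor is idle. Its values at `t < 0` play no role. -/
abbrev Schedule (n : ℕ) := ℝ → Option (Fin n × ℕ)

/-- The amount of processor time that job `k` has received in `[0, t)`. -/
def service {n : ℕ} (σ : Schedule n) (k : Fin n × ℕ) (t : ℝ) : ℝ :=
  volume.real (Ico 0 t ∩ {s | σ s = some k})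

/-- The absolute deadline of job `k`. -/
def absDeadline {n : ℕ} (D : Fin n → ℝ) (r : Fin n → ℕ → ℝ) (k : Fin n × ℕ) : ℝ :=
  r k.1 k.2 + D k.1

/-- Job `k` is pending at time `t`: it is released and not yet completed. -/
def IsPending {n : ℕ} (C : Fin n → ℝ) (r : Fin n → ℕ → ℝ) (σ : Schedule n)
    (k : Fin n × ℕ) (t : ℝ) : Prop :=
  r k.1 k.2 ≤ t ∧ service σ k t < C k.1

/-- `σ` is a schedule produced by preemptive Earliest Deadline First: at every instant a pending job
with earliest absolute deadline executes (ties may be broken arbitrarily), and the processor idles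
only if no job is pending. -/
structure IsEDFSchedule {n : ℕ} (D C : Fin n → ℝ) (r : Fin n → ℕ → ℝ) (σ : Schedule n) :
    Prop where
  measurableSet : ∀ k, MeasurableSet {s | σ s = some k}
  pending : ∀ t, 0 ≤ t → ∀ k, σ t = some k → IsPending C r σ k t
  earliest : ∀ t, 0 ≤ t → ∀ k, σ t = some k →
    ∀ k', IsPending C r σ k' t → absDeadline D r k ≤ absDeadline D r k'
  idle : ∀ t, 0 ≤ t → σ t = none → ∀ k, ¬ IsPending C r σ k t

/-- Every job has received its whole execution time by its absolute deadline. -/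
def MeetsDeadlines {n : ℕ} (D C : Fin n → ℝ) (r : Fin n → ℕ → ℝ) (σ : Schedule n) : Prop :=
  ∀ k : Fin n × ℕ, C k.1 ≤ service σ k (absDeadline D r k)

/-- Preemptive EDF schedules the jobs released according to `r`: EDF schedules exist, and none of
them misses a deadline. -/
def SchedulableFor {n : ℕ} (D C : Fin n → ℝ) (r : Fin n → ℕ → ℝ) : Prop :=
  (∃ σ, IsEDFSchedule D C r σ) ∧ ∀ σ, IsEDFSchedule D C r σ → MeetsDeadlines D C r σ

/-- The periodic task set (with synchronous releases) is scheduled by preemptive EDF. -/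
def Schedulable {n : ℕ} (T D C : Fin n → ℝ) : Prop :=
  SchedulableFor D C (periodicRelease T)

/-- The task set is scheduled by preemptive EDF whatever its sporadic releases are. -/
def SporadicallySchedulable {n : ℕ} (T D C : Fin n → ℝ) : Prop :=
  ∀ r, IsSporadicRelease T r → SchedulableFor D C r

/-- The absolute deadlines `j * T i + D i` up to `H + max D`, together with the fictitious point `0`.
(`⨆ i, D i` is the maximum as soon as `n ≠ 0`.) -/
def deadlineSet {n : ℕ} (T D : Fin n → ℝ) (H : ℝ) : Set ℝ :=
  {t | (∃ i, ∃ j : ℕ, t = j * T i + D i) ∧ t ≤ H + ⨆ i, D i} ∪ {0}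

/-- The vector of coefficients `h(t)`. -/
def h {n : ℕ} (T D : Fin n → ℝ) (t : ℝ) : Fin n → ℝ := fun i =>
  if t = 0 then 1 / T i else 1 / t * max 0 ((⌊(t - D i) / T i⌋ : ℝ) + 1)

/-- A convex polyhedron: the intersection of finitely many closed half-spaces. -/
def IsPolyhedron {n : ℕ} (S : Set (Fin n → ℝ)) : Prop :=
  ∃ (m : ℕ) (a : Fin m → Fin n → ℝ) (b : Fin m → ℝ), S = {x | ∀ k, a k ⬝ᵥ x ≤ b k}

end EDF

end

/-!
The proof is the processor demand criterion. The demand `demand T D C L` is the largest execution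
time that jobs released and due in an interval of length `L` can need.

* EDF meets all deadlines as soon as the demand is at most `L` for all `L > 0`
  (`IsEDFSchedule.meetsDeadlines`): if a job with deadline `d` is late, then after the last
  instant `s` up to `d` at which no job with deadline at most `d` is pending, the processor
  executes only jobs released and due in `[s, d]`, without interruption, and does not complete
  them, so their demand exceeds `d - s`. For sporadic releases at most `jobCount T D i (d - s)` of
  them belong to task `i`.
* Conversely, with synchronous periodic releases the demand for `L` is that of the jobs due by `L`,
  and a schedule which meets all deadlines serves them within `[0, L]`
  (`Schedulable.demand_le`). Letting `L` tend to infinity bounds the utilization by `1`, which is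
  the condition at the fictitious point `0` (`utilization_le_one`).
* The demand is constant between deadlines and, beyond the largest relative deadline, grows over a
  hyperperiod by `H` times the utilization; so the points of `deadlineSet` suffice
  (`demand_le_of_deadlineSet`).

EDF schedules exist (`exists_isEDFSchedule`) because only finitely many jobs are due by any given
time. The jobs can be numbered by increasing deadlines, and one job after the other is assigned the
first instants after its release that the earlier ones leave free. This avoids stepping from one
scheduling event to the next.
-/

namespace EDF

/-! ### Processor time in an interval -/

theorem measureReal_Ico_inter_mono (a : ℝ) (A : Set ℝ) :
    Monotone fun t => volume.real (Ico a t ∩ A) := fun s t hst =>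
  measureReal_mono (inter_subset_inter_left _ (Ico_subset_Ico_right hst))
    (measure_ne_top_of_subset inter_subset_left (by simp))

theorem continuous_measureReal_Ico_inter (a : ℝ) (A : Set ℝ) :
    Continuous fun t => volume.real (Ico a t ∩ A) := by
  refine (LipschitzWith.of_le_add fun x y => ?_).continuous
  have hsub : Ico a x ∩ A ⊆ (Ico a y ∩ A) ∪ Ico y x := by
    rintro u ⟨⟨h1, h2⟩, h3⟩
    rcases lt_or_ge u y with h | h
    · exact Or.inl ⟨⟨h1, h⟩, h3⟩
    · exact Or.inr ⟨h, h2⟩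
  have hfin : volume ((Ico a y ∩ A) ∪ Ico y x) ≠ ⊤ :=
    measure_union_ne_top (measure_ne_top_of_subset inter_subset_left (by simp)) (by simp)
  calc volume.real (Ico a x ∩ A) ≤ volume.real ((Ico a y ∩ A) ∪ Ico y x) :=
        measureReal_mono hsub hfin
    _ ≤ volume.real (Ico a y ∩ A) + volume.real (Ico y x) := measureReal_union_le _ _
    _ ≤ volume.real (Ico a y ∩ A) + dist x y := by
        gcongr
        rw [Real.volume_real_Ico, Real.dist_eq]
        exact max_le (le_abs_self _) (abs_nonneg _)

section Service

variable {n : ℕ} {D C : Fin n → ℝ} {r : Fin n → ℕ → ℝ} {σ : Schedule n}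

theorem service_mono (σ : Schedule n) (k : Fin n × ℕ) : Monotone (service σ k) :=
  measureReal_Ico_inter_mono _ _

theorem service_nonneg (σ : Schedule n) (k : Fin n × ℕ) (t : ℝ) : 0 ≤ service σ k t :=
  measureReal_nonneg

/-- An EDF schedule never gives a job more than its execution time: once the service, which is
continuous in time, has reached `C`, the job is no longer pending and does not execute. -/
theorem IsEDFSchedule.service_le (hσ : IsEDFSchedule D C r σ) (hC : ∀ i, 0 ≤ C i)
    (k : Fin n × ℕ) (t : ℝ) : service σ k t ≤ C k.1 := by
  by_contra! hlt
  have ht : 0 ≤ t := by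
    by_contra! ht
    rw [service, Ico_eq_empty (by linarith), empty_inter, measureReal_empty] at hlt
    exact absurd (hC k.1) (not_le.2 hlt)
  have h0 : service σ k 0 = 0 := by simp [service]
  obtain ⟨v, hv, hvC⟩ := intermediate_value_Icc ht
    (continuous_measureReal_Ico_inter 0 {s | σ s = some k}).continuousOn
    (show C k.1 ∈ Icc (service σ k 0) (service σ k t) from ⟨h0.trans_le (hC _), hlt.le⟩)
  have hsub : Ico 0 t ∩ {s | σ s = some k} ⊆ Ico 0 v ∩ {s | σ s = some k} := by
    rintro u ⟨⟨hu0, hut⟩, huk⟩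
    refine ⟨⟨hu0, ?_⟩, huk⟩
    by_contra! hvu
    exact absurd (hσ.pending u hu0 k huk).2 (not_lt.2 (hvC ▸ service_mono σ k hvu))
  have : service σ k t ≤ C k.1 := hvC ▸ measureReal_mono hsub
    (measure_ne_top_of_subset inter_subset_left (by simp))
  linarith

/-- The processor serves one job at a time. -/
theorem IsEDFSchedule.sum_service_le (hσ : IsEDFSchedule D C r σ) (J : Finset (Fin n × ℕ))
    {t : ℝ} (ht : 0 ≤ t) : ∑ k ∈ J, service σ k t ≤ t := by
  have hU : volume.real (⋃ k ∈ J, Ico 0 t ∩ {s | σ s = some k}) = ∑ k ∈ J, service σ k t := by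
    refine measureReal_biUnion_finset ?_ (fun k _ => measurableSet_Ico.inter (hσ.measurableSet k))
      fun k _ => measure_ne_top_of_subset inter_subset_left (by simp)
    intro k _ k' _ hkk'
    refine Set.disjoint_left.2 fun s hs hs' => hkk' ?_
    exact Option.some_injective _ (hs.2.symm.trans hs'.2)
  calc ∑ k ∈ J, service σ k t = _ := hU.symm
    _ ≤ volume.real (Ico 0 t) :=
        measureReal_mono (iUnion₂_subset fun k _ => inter_subset_left) (by simp)
    _ = t := by simp [Real.volume_real_Ico, ht]

/-! ### A missed deadline forces an overloaded interval -/

/-- The processor demand criterion. If every interval `[s, d]` has at least as much length as the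
jobs with both release and deadline in `[s, d]` need, then EDF meets all deadlines. If a job with
deadline `d` were late, let `s` be the supremum of the instants up to `d` at which no job with
deadline at most `d` is pending: after `s` only jobs released and due in `[s, d]` execute, they
execute without interruption, and they are not all completed by `d`. -/
theorem IsEDFSchedule.meetsDeadlines (hσ : IsEDFSchedule D C r σ) (hC : ∀ i, 0 ≤ C i)
    (hD : ∀ i, 0 < D i) (hr : ∀ i j, 0 ≤ r i j)
    (hfin : ∀ d, {k | absDeadline D r k ≤ d}.Finite)
    (hdem : ∀ s d, 0 ≤ s → s < d → ∀ J : Finset (Fin n × ℕ),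
      (∀ k ∈ J, s ≤ r k.1 k.2 ∧ absDeadline D r k ≤ d) → ∑ k ∈ J, C k.1 ≤ d - s) :
    MeetsDeadlines D C r σ := by
  intro k₀
  by_contra! hmiss
  set d := absDeadline D r k₀ with hd
  -- the instant `0` is included to make `P` nonempty; no job is released before it
  set P : Set ℝ := insert 0
    {t | t ∈ Icc 0 d ∧ ∀ k, absDeadline D r k ≤ d → ¬ IsPending C r σ k t} with hP
  have hd0 : 0 < d := add_pos_of_nonneg_of_pos (hr _ _) (hD _)
  have hPd : ∀ t ∈ P, t ≤ d := by
    rintro t (rfl | ht)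
    exacts [hd0.le, ht.1.2]
  have hbdd : BddAbove P := ⟨d, hPd⟩
  have hne : P.Nonempty := ⟨0, mem_insert _ _⟩
  set s := sSup P with hs
  have hs0 : 0 ≤ s := le_csSup hbdd (mem_insert _ _)
  -- a job of deadline at most `d` which is incomplete at `s` was not released before `s`
  have hrel : ∀ k, absDeadline D r k ≤ d → service σ k s < C k.1 → s ≤ r k.1 k.2 := by
    intro k hk hlt
    by_contra! hks
    obtain ⟨t, htP, hkt⟩ := exists_lt_of_lt_csSup hne hks
    rcases htP with rfl | ht
    · exact absurd (hr k.1 k.2) (not_le.2 hkt)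
    · exact ht.2 k hk ⟨hkt.le, (service_mono σ k (le_csSup hbdd (Or.inr ht))).trans_lt hlt⟩
  have hsd' : s ≤ d := csSup_le hne hPd
  have hs₀ : s ≤ r k₀.1 k₀.2 := hrel k₀ le_rfl ((service_mono σ k₀ hsd').trans_lt hmiss)
  have hsd : s < d := hs₀.trans_lt (lt_add_of_pos_right _ (hD _))
  set J : Finset (Fin n × ℕ) := (hfin d).toFinset.filter fun k => s ≤ r k.1 k.2 with hJ
  have hJmem : ∀ k, k ∈ J ↔ absDeadline D r k ≤ d ∧ s ≤ r k.1 k.2 := by simp [hJ]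
  have hcover : Ioo s d ⊆ ⋃ k ∈ J, Ico 0 d ∩ {u | σ u = some k} := by
    rintro t ⟨hst, htd⟩
    have ht0 : 0 ≤ t := hs0.trans hst.le
    have : t ∉ P := fun h => absurd (le_csSup hbdd h) (not_le.2 hst)
    obtain ⟨k', hk', hpend⟩ : ∃ k', absDeadline D r k' ≤ d ∧ IsPending C r σ k' t := by
      by_contra! hcon
      exact this (Or.inr ⟨⟨ht0, htd.le⟩, hcon⟩)
    rcases hk : σ t with _ | k
    · exact absurd hpend (hσ.idle t ht0 hk k')
    · have hkd := (hσ.earliest t ht0 k hk k' hpend).trans hk'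
      have hkp := hσ.pending t ht0 k hk
      refine mem_iUnion₂.2 ⟨k, (hJmem k).2 ⟨hkd, hrel k hkd ?_⟩, ⟨ht0, htd⟩, hk⟩
      exact (service_mono σ k hst.le).trans_lt hkp.2
  have h1 : d - s ≤ ∑ k ∈ J, service σ k d := by
    calc d - s = volume.real (Ioo s d) := by simp [Real.volume_real_Ioo, hsd.le]
      _ ≤ volume.real (⋃ k ∈ J, Ico 0 d ∩ {u | σ u = some k}) :=
          measureReal_mono hcover (measure_ne_top_of_subset
            (iUnion₂_subset fun k _ => inter_subset_left) (by simp : volume (Ico 0 d) ≠ ⊤))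
      _ ≤ ∑ k ∈ J, service σ k d := measureReal_biUnion_finset_le _ _
  have h2 : ∑ k ∈ J, service σ k d < ∑ k ∈ J, C k.1 :=
    Finset.sum_lt_sum (fun k _ => hσ.service_le hC k d)
      ⟨k₀, (hJmem k₀).2 ⟨le_rfl, hs₀⟩, hmiss⟩
  have h3 := hdem s d hs0 hsd J fun k hk => ((hJmem k).1 hk).symm
  linarith

end Service

/-! ### Existence of EDF schedules -/

section Priority

variable {α : Type*} (rank : α → ℕ) (rel c : α → ℝ)

/-- The set of instants at which job `k` executes when the processor always serves the pending job
of least `rank`: those from its release on at which no job of smaller rank executes, as long as the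
time left over to it by these jobs has not reached its execution time. -/
def execSet (k : α) : Set ℝ :=
  {t | rel k ≤ t ∧ t ∉ (⋃ k', ⋃ (_ : rank k' < rank k), execSet k') ∧
    volume.real (Ico (rel k) t ∩ (⋃ k', ⋃ (_ : rank k' < rank k), execSet k')ᶜ) < c k}
termination_by rank k

/-- The instants at which a job of smaller rank than `k` executes. -/
def busySet (k : α) : Set ℝ := ⋃ k', ⋃ (_ : rank k' < rank k), execSet rank rel c k'

theorem mem_execSet {k : α} {t : ℝ} : t ∈ execSet rank rel c k ↔ rel k ≤ t ∧
    t ∉ busySet rank rel c k ∧ volume.real (Ico (rel k) t ∩ (busySet rank rel c k)ᶜ) < c k := by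
  rw [execSet]
  rfl

theorem measurableSet_execSet [Countable α] (k : α) : MeasurableSet (execSet rank rel c k) := by
  induction hm : rank k using Nat.strong_induction_on generalizing k with
  | _ m ih =>
    have hb : MeasurableSet (busySet rank rel c k) :=
      MeasurableSet.iUnion fun k' => MeasurableSet.iUnion fun hk' => ih _ (hm ▸ hk') k' rfl
    have hset : execSet rank rel c k = Ici (rel k) ∩ ((busySet rank rel c k)ᶜ ∩
        {t | volume.real (Ico (rel k) t ∩ (busySet rank rel c k)ᶜ) < c k}) := by
      ext t
      exact mem_execSet rank rel c
    rw [hset]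
    exact measurableSet_Ici.inter (hb.compl.inter (measurableSet_lt
      (continuous_measureReal_Ico_inter _ _).measurable measurable_const))

theorem eq_of_mem_execSet (hinj : Function.Injective rank) {k k' : α} {t : ℝ}
    (hk : t ∈ execSet rank rel c k) (hk' : t ∈ execSet rank rel c k') : k = k' := by
  refine hinj (le_antisymm ?_ ?_) <;> by_contra! hlt
  · exact ((mem_execSet rank rel c).1 hk).2.1 (mem_iUnion₂.2 ⟨k', hlt, hk'⟩)
  · exact ((mem_execSet rank rel c).1 hk').2.1 (mem_iUnion₂.2 ⟨k, hlt, hk⟩)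

/-- A job has received less than its execution time exactly when less than this time was left over
to it by the jobs of smaller rank. -/
theorem service_execSet_lt_iff (hrel : ∀ k, 0 ≤ rel k) {k : α} {t : ℝ} (ht : rel k ≤ t) :
    volume.real (Ico 0 t ∩ execSet rank rel c k) < c k ↔
      volume.real (Ico (rel k) t ∩ (busySet rank rel c k)ᶜ) < c k := by
  set f : ℝ → ℝ := fun t => volume.real (Ico (rel k) t ∩ (busySet rank rel c k)ᶜ) with hf
  have hsubset : ∀ v, (∀ u < v, f u < c k) → v ≤ t →
      Ico (rel k) v ∩ (busySet rank rel c k)ᶜ ⊆ Ico 0 t ∩ execSet rank rel c k := by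
    rintro v hv hvt u ⟨⟨hu1, hu2⟩, hu3⟩
    exact ⟨⟨(hrel k).trans hu1, hu2.trans_le hvt⟩,
      (mem_execSet rank rel c).2 ⟨hu1, hu3, hv u hu2⟩⟩
  have hfin : volume (Ico 0 t ∩ execSet rank rel c k) ≠ ⊤ :=
    measure_ne_top_of_subset inter_subset_left (by simp)
  constructor
  · intro hlt
    by_contra! hge
    -- at an instant `v` where the time left over equals a value `y` below `c k`, the service is `y`
    obtain ⟨y, hy1, hy2⟩ := exists_between hlt
    have hy0 : 0 ≤ y := measureReal_nonneg.trans hy1.le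
    obtain ⟨v, hv, hvy⟩ := intermediate_value_Icc ht
      (continuous_measureReal_Ico_inter (rel k) (busySet rank rel c k)ᶜ).continuousOn
      (show y ∈ Icc (f (rel k)) (f t) from ⟨by simpa [hf] using hy0, hy2.le.trans hge⟩)
    have : f v ≤ volume.real (Ico 0 t ∩ execSet rank rel c k) := measureReal_mono
      (hsubset v (fun u hu => ((measureReal_Ico_inter_mono _ _ hu.le).trans_eq hvy).trans_lt hy2)
        hv.2) hfin
    have hvy' : f v = y := hvy
    linarith
  · intro hlt
    refine (measureReal_mono ?_ (measure_ne_top_of_subset inter_subset_left (by simp))).trans_lt hlt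
    rintro u ⟨⟨-, hu2⟩, hu3⟩
    have := (mem_execSet rank rel c).1 hu3
    exact ⟨⟨this.1, hu2⟩, this.2.1⟩

end Priority

/-- Jobs of which only finitely many are due by any given time can be numbered by increasing
deadlines. -/
theorem exists_rank {α : Type*} [Countable α] (d : α → ℝ) (hfin : ∀ x, {k | d k ≤ x}.Finite) :
    ∃ rank : α → ℕ, Function.Injective rank ∧ ∀ k k', d k < d k' → rank k < rank k' := by
  obtain ⟨e, he⟩ := exists_injective_nat α
  set key : α → ℝ ×ₗ ℕ := fun k => toLex (d k, e k) with hkey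
  have hkeyinj : Function.Injective key := fun k k' h => he (congrArg (fun p => (ofLex p).2) h)
  have hlow : ∀ k, {k' | key k' < key k}.Finite := fun k =>
    (hfin (d k)).subset fun k' hk' => by
      rcases Prod.Lex.toLex_lt_toLex.1 hk' with h | h
      exacts [h.le, h.1.le]
  have hmono : ∀ k k', key k < key k' →
      {l | key l < key k}.ncard < {l | key l < key k'}.ncard := fun k k' h =>
    Set.ncard_lt_ncard ⟨fun l hl => lt_trans hl h, fun hsub =>
      lt_irrefl (key k) (hsub h : key k < key k)⟩ (hlow k')
  refine ⟨fun k => {l | key l < key k}.ncard, fun k k' hkk' => hkeyinj ?_, fun k k' h =>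
    hmono k k' (Prod.Lex.toLex_lt_toLex.2 (Or.inl h))⟩
  rcases lt_trichotomy (key k) (key k') with h | h | h
  · exact absurd hkk' (hmono k k' h).ne
  · exact h
  · exact absurd hkk' (hmono k' k h).ne'

open Classical in
theorem exists_isEDFSchedule {n : ℕ} (D C : Fin n → ℝ) (r : Fin n → ℕ → ℝ)
    (hr : ∀ i j, 0 ≤ r i j) (hfin : ∀ d, {k | absDeadline D r k ≤ d}.Finite) :
    ∃ σ, IsEDFSchedule D C r σ := by
  obtain ⟨rank, hinj, hrank⟩ := exists_rank (absDeadline D r) hfin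
  set rel : Fin n × ℕ → ℝ := fun k => r k.1 k.2 with hrel
  set c : Fin n × ℕ → ℝ := fun k => C k.1 with hc
  set σ : Schedule n := fun t =>
    if hex : ∃ k, t ∈ execSet rank rel c k then some hex.choose else none with hσ
  have hsome : ∀ t k, σ t = some k ↔ t ∈ execSet rank rel c k := by
    intro t k
    by_cases hex : ∃ k, t ∈ execSet rank rel c k
    · simp only [hσ, dif_pos hex, Option.some.injEq]
      exact ⟨fun h => h ▸ hex.choose_spec,
        fun h => eq_of_mem_execSet rank rel c hinj hex.choose_spec h⟩
    · simp only [hσ, dif_neg hex]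
      exact ⟨fun h => by simp at h, fun h => absurd ⟨k, h⟩ hex⟩
  have hset : ∀ k, {t | σ t = some k} = execSet rank rel c k := fun k => by
    ext t
    exact hsome t k
  have hpend : ∀ k t, IsPending C r σ k t ↔ rel k ≤ t ∧
      volume.real (Ico (rel k) t ∩ (busySet rank rel c k)ᶜ) < c k := by
    intro k t
    rw [IsPending, service, hset]
    exact and_congr_right fun h => service_execSet_lt_iff rank rel c (fun k => hr _ _) h
  -- a pending job executes, unless a job of smaller rank does
  have hexec : ∀ k t, IsPending C r σ k t → ∃ k', rank k' ≤ rank k ∧ σ t = some k' := by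
    intro k t h
    by_cases hb : t ∈ busySet rank rel c k
    · obtain ⟨k', hk', ht⟩ := mem_iUnion₂.1 hb
      exact ⟨k', le_of_lt hk', (hsome t k').2 ht⟩
    · have := (hpend k t).1 h
      exact ⟨k, le_rfl, (hsome t k).2 ((mem_execSet rank rel c).2 ⟨this.1, hb, this.2⟩)⟩
  refine ⟨σ, fun k => hset k ▸ measurableSet_execSet rank rel c k, fun t _ k hk => ?_,
    fun t _ k hk k' hk' => ?_, fun t _ hnone k hk => ?_⟩
  · have := (mem_execSet rank rel c).1 ((hsome t k).1 hk)
    exact (hpend k t).2 ⟨this.1, this.2.2⟩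
  · obtain ⟨l, hl, htl⟩ := hexec k' t hk'
    obtain rfl : k = l := Option.some_injective _ (hk.symm.trans htl)
    by_contra! hlt
    exact absurd (hrank _ _ hlt) (not_lt.2 hl)
  · obtain ⟨l, -, htl⟩ := hexec k t hk
    simp [hnone] at htl

end EDF

namespace EDF

section Demand

variable {n : ℕ} {T D C : Fin n → ℝ} {r : Fin n → ℕ → ℝ} {H : ℝ}

/-! ### Sporadic releases -/

theorem isSporadicRelease_periodicRelease (T : Fin n → ℝ) :
    IsSporadicRelease T (periodicRelease T) := by
  refine ⟨fun i => by simp [periodicRelease], fun i j => le_of_eq ?_⟩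
  simp only [periodicRelease]
  push_cast
  ring

theorem IsSporadicRelease.add_mul_le (hr : IsSporadicRelease T r) (i : Fin n) (j m : ℕ) :
    r i j + m * T i ≤ r i (j + m) := by
  induction m with
  | zero => simp
  | succ m ih =>
    have := hr.2 i (j + m)
    rw [← add_assoc]
    push_cast
    linarith

theorem IsSporadicRelease.mul_le (hr : IsSporadicRelease T r) (i : Fin n) (j : ℕ) :
    j * T i ≤ r i j := by
  have h1 := hr.add_mul_le i 0 j
  have h2 := hr.1 i
  rw [zero_add] at h1
  linarith

theorem IsSporadicRelease.nonneg (hr : IsSporadicRelease T r) (hT : ∀ i, 0 < T i) (i : Fin n)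
    (j : ℕ) : 0 ≤ r i j :=
  (mul_nonneg j.cast_nonneg (hT i).le).trans (hr.mul_le i j)

/-- The number of deadlines `j * T i + D i` up to `L`: the maximum of `0` and
`⌊(L - D i) / T i⌋ + 1`. -/
noncomputable def jobCount (T D : Fin n → ℝ) (i : Fin n) (L : ℝ) : ℕ :=
  (⌊(L - D i) / T i⌋ + 1).toNat

theorem cast_jobCount (T D : Fin n → ℝ) (i : Fin n) (L : ℝ) :
    (jobCount T D i L : ℝ) = max 0 ((⌊(L - D i) / T i⌋ : ℝ) + 1) := by
  rw [jobCount, ← Int.cast_natCast, Int.toNat_eq_max, max_comm]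
  push_cast
  rfl

theorem lt_jobCount (hT : ∀ i, 0 < T i) {i : Fin n} {L : ℝ} {j : ℕ} :
    j < jobCount T D i L ↔ j * T i + D i ≤ L := by
  rw [jobCount, Int.lt_toNat, Int.lt_add_one_iff, Int.le_floor, le_div_iff₀ (hT i),
    le_sub_iff_add_le]
  simp

theorem IsSporadicRelease.finite_absDeadline_le (hr : IsSporadicRelease T r)
    (hT : ∀ i, 0 < T i) (d : ℝ) : {k | absDeadline D r k ≤ d}.Finite := by
  refine (Set.finite_iUnion fun i =>
    (Set.finite_Iio (jobCount T D i d)).image (Prod.mk i)).subset ?_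
  rintro ⟨i, j⟩ hk
  refine mem_iUnion.2 ⟨i, j, (lt_jobCount hT).2 ?_, rfl⟩
  exact (add_le_add_left (hr.mul_le i j) (D i)).trans hk

/-! ### The demand bound function -/

/-- The demand bound function: the largest execution time which jobs with both release and deadline
in an interval of length `L` can need. -/
noncomputable def demand (T D C : Fin n → ℝ) (L : ℝ) : ℝ := ∑ i, jobCount T D i L * C i

theorem sum_jobs_eq (J : Finset (Fin n × ℕ)) :
    ∑ k ∈ J, C k.1 = ∑ i, ((J.filter fun k => k.1 = i).card : ℝ) * C i := by
  rw [← Finset.sum_fiberwise J Prod.fst]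
  refine Finset.sum_congr rfl fun i _ => ?_
  rw [← nsmul_eq_mul]
  exact Finset.sum_eq_card_nsmul fun k hk => by rw [(Finset.mem_filter.1 hk).2]

theorem IsSporadicRelease.sum_le_demand (hr : IsSporadicRelease T r) (hT : ∀ i, 0 < T i)
    (hC : ∀ i, 0 ≤ C i) {s d : ℝ} {J : Finset (Fin n × ℕ)}
    (hJ : ∀ k ∈ J, s ≤ r k.1 k.2 ∧ absDeadline D r k ≤ d) :
    ∑ k ∈ J, C k.1 ≤ demand T D C (d - s) := by
  rw [sum_jobs_eq]
  refine Finset.sum_le_sum fun i _ => mul_le_mul_of_nonneg_right ?_ (hC i)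
  rw [Nat.cast_le]
  rcases (J.filter fun k => k.1 = i).eq_empty_or_nonempty with he | hne
  · simp [he]
  -- all jobs of task `i` in `J` follow the first one, `k₀`, by less than `jobCount` periods
  obtain ⟨k₀, hk₀, hmin⟩ := Finset.exists_min_image _ Prod.snd hne
  have hsub : (J.filter fun k => k.1 = i) ⊆
      (Finset.range (jobCount T D i (d - s))).image fun m => (i, k₀.2 + m) := by
    rintro ⟨i', j⟩ hk
    obtain ⟨hkJ, rfl⟩ := Finset.mem_filter.1 hk
    obtain ⟨m, rfl⟩ := Nat.exists_eq_add_of_le (hmin _ hk)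
    refine Finset.mem_image.2 ⟨m, Finset.mem_range.2 ((lt_jobCount hT).2 ?_), rfl⟩
    obtain ⟨hk₀J, hk₀i⟩ := Finset.mem_filter.1 hk₀
    have h1 := (hJ _ hk₀J).1
    rw [hk₀i] at h1
    have h2 := (hJ _ hkJ).2
    have h3 := hr.add_mul_le i' k₀.2 m
    simp only [absDeadline] at h1 h2 h3
    linarith
  exact (Finset.card_le_card hsub).trans (Finset.card_image_le.trans_eq (Finset.card_range _))

/-- With synchronous periodic releases the demand is attained on the intervals `[0, L]`. -/
theorem demand_le_sum_periodic (hT : ∀ i, 0 < T i) (hC : ∀ i, 0 ≤ C i) {L : ℝ}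
    {J : Finset (Fin n × ℕ)} (hJ : ∀ k, absDeadline D (periodicRelease T) k ≤ L → k ∈ J) :
    demand T D C L ≤ ∑ k ∈ J, C k.1 := by
  rw [sum_jobs_eq]
  refine Finset.sum_le_sum fun i _ => mul_le_mul_of_nonneg_right ?_ (hC i)
  rw [Nat.cast_le, ← Finset.card_range (jobCount T D i L),
    ← Finset.card_image_of_injective (Finset.range _) (Prod.mk_right_injective i)]
  refine Finset.card_le_card fun k hk => ?_
  obtain ⟨j, hj, rfl⟩ := Finset.mem_image.1 hk
  exact Finset.mem_filter.2 ⟨hJ _ ((lt_jobCount hT).1 (Finset.mem_range.1 hj)), rfl⟩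

theorem h_zero_dotProduct (T D C : Fin n → ℝ) : h T D 0 ⬝ᵥ C = ∑ i, C i / T i := by
  refine Finset.sum_congr rfl fun i _ => ?_
  rw [h, if_pos rfl]
  ring

theorem h_dotProduct (T D C : Fin n → ℝ) {t : ℝ} (ht : t ≠ 0) :
    h T D t ⬝ᵥ C = demand T D C t / t := by
  rw [demand, Finset.sum_div]
  refine Finset.sum_congr rfl fun i _ => ?_
  rw [h, if_neg ht, cast_jobCount]
  ring

/-- The average demand approaches the utilization, which is therefore at most `1` if the demand
never exceeds the length of the interval. -/
theorem utilization_le_one (hC : ∀ i, 0 ≤ C i)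
    (hdem : ∀ L, 0 < L → demand T D C L ≤ L) : ∑ i, C i / T i ≤ 1 := by
  by_contra! hU
  set U := ∑ i, C i / T i with hUdef
  set K := ∑ i, D i / T i * C i with hK
  have hlow : ∀ L, L * U - K ≤ demand T D C L := by
    intro L
    rw [hUdef, hK, Finset.mul_sum, ← Finset.sum_sub_distrib]
    refine Finset.sum_le_sum fun i _ => ?_
    have h1 : (L - D i) / T i ≤ jobCount T D i L := by
      rw [cast_jobCount]
      exact (Int.lt_floor_add_one _).le.trans (le_max_right _ _)
    calc L * (C i / T i) - D i / T i * C i = (L - D i) / T i * C i := by ring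
      _ ≤ _ := mul_le_mul_of_nonneg_right h1 (hC i)
  have hU' : 0 < U - 1 := sub_pos.2 hU
  have hL : 0 < (|K| + 1) / (U - 1) := by positivity
  have h1 := (hlow _).trans (hdem _ hL)
  have h2 : (|K| + 1) / (U - 1) * (U - 1) = |K| + 1 := div_mul_cancel₀ _ hU'.ne'
  have h3 := le_abs_self K
  linarith

/-! ### Reduction to finitely many interval lengths -/

/-- Beyond the largest relative deadline, the demand grows over a hyperperiod by `H` times the
utilization. -/
theorem demand_eq_sub_hyperperiod (hT : ∀ i, 0 < T i) (hH : IsHyperperiod T H) {L : ℝ}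
    (hL : ∀ i, H + D i ≤ L) :
    demand T D C L = demand T D C (L - H) + H * ∑ i, C i / T i := by
  rw [demand, demand, Finset.mul_sum, ← Finset.sum_add_distrib]
  refine Finset.sum_congr rfl fun i _ => ?_
  obtain ⟨k, hk⟩ := hH.1.2 i
  have hTi := (hT i).ne'
  have hx : (L - D i) / T i = (L - H - D i) / T i + k := by
    rw [hk]
    field_simp
    ring
  have hnn : 0 ≤ (⌊(L - H - D i) / T i⌋ : ℝ) := by
    exact_mod_cast Int.floor_nonneg.2 (div_nonneg (by linarith [hL i]) (hT i).le)
  rw [cast_jobCount, cast_jobCount, hx, Int.floor_add_natCast, Int.cast_add, Int.cast_natCast,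
    max_eq_right (by positivity), max_eq_right (by positivity), hk]
  field_simp
  ring

theorem finite_deadlineSet (hT : ∀ i, 0 < T i) : (deadlineSet T D H).Finite := by
  refine Set.Finite.union ?_ (Set.finite_singleton 0)
  refine (((isSporadicRelease_periodicRelease T).finite_absDeadline_le (D := D) hT
    (H + ⨆ i, D i)).image (absDeadline D (periodicRelease T))).subset ?_
  rintro t ⟨⟨i, j, rfl⟩, ht⟩
  exact ⟨(i, j), ht, rfl⟩

/-- The demand is constant between deadlines, which settles `L ≤ H + max D`; a larger `L` can be
shortened by `H` repeatedly, since the utilization is at most `1`. -/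
theorem demand_le_of_deadlineSet (hT : ∀ i, 0 < T i) (hD : ∀ i, 0 < D i) (hC : ∀ i, 0 ≤ C i)
    (hH : IsHyperperiod T H) (hcond : ∀ t ∈ deadlineSet T D H, h T D t ⬝ᵥ C ≤ 1) {L : ℝ}
    (hL : 0 < L) : demand T D C L ≤ L := by
  have hH0 : 0 < H := hH.1.1
  have hDle : ∀ i, D i ≤ ⨆ i, D i := fun i => le_ciSup (Set.finite_range D).bddAbove i
  have hU : ∑ i, C i / T i ≤ 1 := h_zero_dotProduct T D C ▸ hcond 0 (Or.inr rfl)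
  -- up to `H + max D`, compare with the largest deadline `t ≤ L`
  have hsmall : ∀ L, 0 < L → L ≤ H + ⨆ i, D i → demand T D C L ≤ L := by
    intro L hL hLle
    set S : Set ℝ := {t | (∃ i, ∃ j : ℕ, t = j * T i + D i) ∧ t ≤ L} with hS
    have hSsub : S ⊆ deadlineSet T D H := fun t ht => Or.inl ⟨ht.1, ht.2.trans hLle⟩
    rcases S.eq_empty_or_nonempty with he | hne
    · have : demand T D C L = 0 := Finset.sum_eq_zero fun i _ => by
        have : jobCount T D i L = 0 := by
          by_contra hpos
          have h0 := (lt_jobCount hT).1 (Nat.pos_of_ne_zero hpos)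
          exact (he ▸ notMem_empty _ : _ ∉ S) ⟨⟨i, 0, rfl⟩, h0⟩
        simp [this]
      rw [this]
      exact hL.le
    · obtain ⟨t, ht, hmax⟩ := Set.exists_max_image S id
        ((finite_deadlineSet hT).subset hSsub) hne
      have ht0 : 0 < t := by
        obtain ⟨⟨i, j, rfl⟩, -⟩ := ht
        exact add_pos_of_nonneg_of_pos (mul_nonneg j.cast_nonneg (hT i).le) (hD i)
      have h1 := hcond t (hSsub ht)
      rw [h_dotProduct T D C ht0.ne', div_le_one ht0] at h1
      refine le_trans (Finset.sum_le_sum fun i _ => ?_) (h1.trans ht.2)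
      refine mul_le_mul_of_nonneg_right (Nat.cast_le.2 ?_) (hC i)
      refine le_of_forall_lt fun j hj => (lt_jobCount hT).2 ?_
      exact hmax _ ⟨⟨i, j, rfl⟩, (lt_jobCount hT).1 hj⟩
  have hstep : ∀ m : ℕ, ∀ L, 0 < L → L ≤ m * H + (H + ⨆ i, D i) → demand T D C L ≤ L := by
    intro m
    induction m with
    | zero => exact fun L hL hLm => hsmall L hL (by simpa using hLm)
    | succ m ih =>
      intro L hL hLm
      rcases le_or_gt L (H + ⨆ i, D i) with hle | hgt
      · exact hsmall L hL hle
      have hDsup : 0 ≤ ⨆ i, D i := Real.iSup_nonneg fun i => (hD i).le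
      push_cast at hLm
      have h1 := ih (L - H) (by linarith) (by linarith)
      have h2 : demand T D C L = _ :=
        demand_eq_sub_hyperperiod hT hH fun i => by linarith [hDle i]
      have h3 := mul_le_mul_of_nonneg_left hU hH0.le
      linarith
  obtain ⟨m, hm⟩ := exists_nat_ge (L / H)
  have hDsup : 0 ≤ ⨆ i, D i := Real.iSup_nonneg fun i => (hD i).le
  exact hstep m L hL (by linarith [(div_le_iff₀ hH0).1 hm])

/-! ### Demand and schedulability -/

theorem Schedulable.demand_le (hT : ∀ i, 0 < T i) (hC : ∀ i, 0 ≤ C i)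
    (hs : Schedulable T D C) {L : ℝ} (hL : 0 < L) : demand T D C L ≤ L := by
  obtain ⟨⟨σ, hσ⟩, hmeet⟩ := hs
  have hfin := (isSporadicRelease_periodicRelease T).finite_absDeadline_le (D := D) hT L
  calc demand T D C L ≤ ∑ k ∈ hfin.toFinset, C k.1 :=
        demand_le_sum_periodic hT hC fun k hk => hfin.mem_toFinset.2 hk
    _ ≤ ∑ k ∈ hfin.toFinset, service σ k L := Finset.sum_le_sum fun k hk =>
        (hmeet σ hσ k).trans (service_mono σ k (hfin.mem_toFinset.1 hk))
    _ ≤ L := hσ.sum_service_le _ hL.le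

theorem IsSporadicRelease.schedulableFor (hr : IsSporadicRelease T r) (hT : ∀ i, 0 < T i)
    (hD : ∀ i, 0 < D i) (hC : ∀ i, 0 ≤ C i) (hdem : ∀ L, 0 < L → demand T D C L ≤ L) :
    SchedulableFor D C r :=
  ⟨exists_isEDFSchedule D C r (hr.nonneg hT) (hr.finite_absDeadline_le hT), fun _ hσ =>
    hσ.meetsDeadlines hC hD (hr.nonneg hT) (hr.finite_absDeadline_le hT)
      fun _ _ _ hsd _ hJ => (hr.sum_le_demand hT hC hJ).trans (hdem _ (sub_pos.2 hsd))⟩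

theorem deadlineSet_condition_of_schedulable (hT : ∀ i, 0 < T i) (hD : ∀ i, 0 < D i)
    (hC : ∀ i, 0 ≤ C i) (hs : Schedulable T D C) {t : ℝ} (ht : t ∈ deadlineSet T D H) :
    h T D t ⬝ᵥ C ≤ 1 := by
  rcases ht with ⟨⟨i, j, rfl⟩, -⟩ | rfl
  · have ht0 : 0 < j * T i + D i :=
      add_pos_of_nonneg_of_pos (mul_nonneg j.cast_nonneg (hT i).le) (hD i)
    rw [h_dotProduct T D C ht0.ne', div_le_one ht0]
    exact Schedulable.demand_le hT hC hs ht0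
  · rw [h_zero_dotProduct]
    exact utilization_le_one hC fun L hL => Schedulable.demand_le hT hC hs hL

end Demand

/-! ### Polyhedra -/

theorem isPolyhedron_of_finite {n : ℕ} {ι : Type*} [Finite ι] (a : ι → Fin n → ℝ) (b : ι → ℝ) :
    IsPolyhedron {x | ∀ k, a k ⬝ᵥ x ≤ b k} := by
  obtain ⟨m, ⟨e⟩⟩ := Finite.exists_equiv_fin ι
  refine ⟨m, a ∘ e.symm, b ∘ e.symm, ?_⟩
  ext x
  exact ⟨fun hx k => hx _, fun hx k => by simpa using hx (e k)⟩

theorem IsPolyhedron.convex {n : ℕ} {S : Set (Fin n → ℝ)} (hS : IsPolyhedron S) :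
    Convex ℝ S := by
  obtain ⟨m, a, b, rfl⟩ := hS
  rw [Set.ofPred_forall]
  exact convex_iInter fun k => convex_halfSpace_le
    ⟨dotProduct_add (a k), fun c x => dotProduct_smul c (a k) x⟩ (b k)

theorem isPolyhedron_nonneg_and {n : ℕ} {S : Set ℝ} (hS : S.Finite) (a : ℝ → Fin n → ℝ) :
    IsPolyhedron {x | (∀ i, 0 ≤ x i) ∧ ∀ t ∈ S, a t ⬝ᵥ x ≤ 1} := by
  have := hS.to_subtype
  convert isPolyhedron_of_finite (ι := Fin n ⊕ S)
    (Sum.elim (fun i => Pi.single i (-1)) fun t => a t) (Sum.elim (fun _ => 0) fun _ => 1) using 1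
  ext x
  simp

end EDF

theorem mainTheorem1 {n : ℕ} (T D : Fin n → ℝ) (H : ℝ)
    (hT : ∀ i, 0 < T i) (hD : ∀ i, 0 < D i) (hH : EDF.IsHyperperiod T H) :
    (EDF.deadlineSet T D H).Finite ∧
    (∀ C : Fin n → ℝ, (∀ i, 0 ≤ C i) →
      (EDF.Schedulable T D C ↔ ∀ t ∈ EDF.deadlineSet T D H, EDF.h T D t ⬝ᵥ C ≤ 1) ∧
      (EDF.SporadicallySchedulable T D C ↔
        ∀ t ∈ EDF.deadlineSet T D H, EDF.h T D t ⬝ᵥ C ≤ 1)) ∧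
    EDF.IsPolyhedron {C : Fin n → ℝ | (∀ i, 0 ≤ C i) ∧ EDF.Schedulable T D C} ∧
    Convex ℝ {C : Fin n → ℝ | (∀ i, 0 ≤ C i) ∧ EDF.Schedulable T D C} := by
  have hfin : (EDF.deadlineSet T D H).Finite := EDF.finite_deadlineSet hT
  have hper := EDF.isSporadicRelease_periodicRelease T
  have hsuff : ∀ C : Fin n → ℝ, (∀ i, 0 ≤ C i) →
      (∀ t ∈ EDF.deadlineSet T D H, EDF.h T D t ⬝ᵥ C ≤ 1) → EDF.SporadicallySchedulable T D C :=
    fun C hC hcond r hr => hr.schedulableFor hT hD hC fun L hL =>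
      EDF.demand_le_of_deadlineSet hT hD hC hH hcond hL
  have hnec : ∀ C : Fin n → ℝ, (∀ i, 0 ≤ C i) → EDF.Schedulable T D C →
      ∀ t ∈ EDF.deadlineSet T D H, EDF.h T D t ⬝ᵥ C ≤ 1 :=
    fun C hC hs t ht => EDF.deadlineSet_condition_of_schedulable hT hD hC hs ht
  have hpoly : EDF.IsPolyhedron {C : Fin n → ℝ | (∀ i, 0 ≤ C i) ∧ EDF.Schedulable T D C} := by
    convert EDF.isPolyhedron_nonneg_and hfin (EDF.h T D) using 1
    ext C
    exact and_congr_right fun hC => ⟨hnec C hC, fun hcond => hsuff C hC hcond _ hper⟩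
  exact ⟨hfin, fun C hC => ⟨⟨hnec C hC, fun hcond => hsuff C hC hcond _ hper⟩,
    ⟨fun hs => hnec C hC (hs _ hper), hsuff C hC⟩⟩, hpoly, hpoly.convex⟩
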